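/- Let $R$ be an associative ring with identity, not necessarily commutative. For $X\subseteq R$ put $\mathbf l(X)=\{r\in R: rx=0\text{ for all }x\in X\}$ and $\mathbf r(X)=\{r\in R: xr=0\text{ for all }x\in X\}$; a right (left) ideal is called a right (left) annihilator if it equals $\mathbf r(X)$ (respectively $\mathbf l(X)$) for some subset $X$ of $R$. A right (left) ideal $I$ is small if $I+K\neq R$ for every proper right (left) ideal $K$ of $R$. Let $J$ be the Jacobson radical of $R$. Then the following conditions are equivalent: 1. $R$ is dual: every right ideal of $R$ is a right annihilator and every left ideal of $R$ is a left annihilator. 2. $R$ is semilocal (that is, $R/J$ is a semisimple ring) and small dual (that is, every small right ideal of $R$ is a right annihilator and every small left ideal of $R$ is a left annihilator). 3. $R$ is semiperfect (that is, $R/J$ is a semisimple ring and every idempotent of $R/J$ lifts to an idempotent of $R$) and small dual. 4. $R$ is two-sided Kasch (that is, every maximal right ideal of $R$ is a right annihilator and every maximal left ideal of $R$ is a left annihilator) and two-sided simple injective (that is, every homomorphism of right $R$-modules $f:I\to R_R$ with $I$ a right ideal of $R$ and simple image extends to a homomorphism $R_R\to R_R$, and likewise for left ideals and homomorphisms of left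 $R$-modules). -/

import Mathlib

/- A left ideal of `R` is a term of `Submodule R R`; a right ideal of `R` is a term of
`Submodule Rᵐᵒᵖ R`, where `MulOpposite.op r • x = x * r`. -/

namespace SmallDualRing

section Annihilators

variable {R : Type*} [Ring R]

/-- The left annihilator `l(X) = {r | r x = 0 for all x ∈ X}`, a left ideal. -/
def leftAnn (X : Set R) : Submodule R R where
  carrier := {r | ∀ x ∈ X, r * x = 0}
  zero_mem' := fun x _ => zero_mul x
  add_mem' := fun ha hb x hx => by rw [add_mul, ha x hx, hb x hx, add_zero]
  smul_mem' := fun c a ha x hx => by rw [smul_eq_mul, mul_assoc, ha x hx, mul_zero]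

/-- The right annihilator `r(X) = {r | x r = 0 for all x ∈ X}`, a right ideal. -/
def rightAnn (X : Set R) : Submodule Rᵐᵒᵖ R where
  carrier := {r | ∀ x ∈ X, x * r = 0}
  zero_mem' := fun x _ => mul_zero x
  add_mem' := fun ha hb x hx => by rw [mul_add, ha x hx, hb x hx, add_zero]
  smul_mem' := fun c a ha x hx => by
    rw [MulOpposite.smul_eq_mul_unop, ← mul_assoc, ha x hx, zero_mul]

/-- A left ideal is a left annihilator if it is `l(X)` for some subset `X` of `R`. -/
def IsLeftAnnihilator (I : Submodule R R) : Prop := ∃ X : Set R, I = leftAnn X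

/-- A right ideal is a right annihilator if it is `r(X)` for some subset `X` of `R`. -/
def IsRightAnnihilator (I : Submodule Rᵐᵒᵖ R) : Prop := ∃ X : Set R, I = rightAnn X

theorem isRightAnnihilator_iff (I : Submodule Rᵐᵒᵖ R) :
    IsRightAnnihilator I ↔ rightAnn (leftAnn (I : Set R) : Set R) = I := by
  constructor
  · rintro ⟨X, rfl⟩
    apply le_antisymm
    · intro a ha x hx
      exact ha x (fun y hy => hy x hx)
    · intro a ha x hx
      exact hx a ha
  · intro h
    exact ⟨_, h.symm⟩

theorem isLeftAnnihilator_iff (I : Submodule R R) :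
    IsLeftAnnihilator I ↔ leftAnn (rightAnn (I : Set R) : Set R) = I := by
  constructor
  · rintro ⟨X, rfl⟩
    apply le_antisymm
    · intro a ha x hx
      exact ha x (fun y hy => hy x hx)
    · intro a ha x hx
      exact hx a ha
  · intro h
    exact ⟨_, h.symm⟩

end Annihilators

/-- A submodule `N` of `M` is small (superfluous) if `N + K ≠ M` for every proper submodule `K`. -/
def IsSmallSubmodule {S M : Type*} [Ring S] [AddCommGroup M] [Module S M]
    (N : Submodule S M) : Prop :=
  ∀ K : Submodule S M, K ≠ ⊤ → N ⊔ K ≠ ⊤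

section Rings

variable (R : Type*) [Ring R]

/-- Every right ideal is a right annihilator. -/
def IsRightDual : Prop := ∀ I : Submodule Rᵐᵒᵖ R, IsRightAnnihilator I

/-- Every left ideal is a left annihilator. -/
def IsLeftDual : Prop := ∀ I : Submodule R R, IsLeftAnnihilator I

/-- A ring is dual if it is left and right dual. -/
def IsDual : Prop := IsLeftDual R ∧ IsRightDual R

/-- Every small right ideal is a right annihilator. -/
def IsRightSmallDual : Prop :=
  ∀ I : Submodule Rᵐᵒᵖ R, IsSmallSubmodule I → IsRightAnnihilator I

/-- Every small left ideal is a left annihilator. -/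
def IsLeftSmallDual : Prop :=
  ∀ I : Submodule R R, IsSmallSubmodule I → IsLeftAnnihilator I

/-- A ring is small dual if it is left and right small dual. -/
def IsSmallDual : Prop := IsLeftSmallDual R ∧ IsRightSmallDual R

/-- A ring is semilocal if its quotient by the Jacobson radical is semisimple. -/
def IsSemilocal : Prop := IsSemisimpleRing (R ⧸ Ring.jacobson R)

/-- A ring is semiperfect if it is semilocal and idempotents lift modulo the Jacobson radical. -/
def IsSemiperfect : Prop :=
  IsSemilocal R ∧
    ∀ a : R ⧸ Ring.jacobson R, IsIdempotentElem a →
      ∃ e : R, IsIdempotentElem e ∧ Ideal.Quotient.mk (Ring.jacobson R) e = a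

/-- Every maximal right ideal is a right annihilator. -/
def IsRightKasch : Prop := ∀ I : Submodule Rᵐᵒᵖ R, IsCoatom I → IsRightAnnihilator I

/-- Every maximal left ideal is a left annihilator. -/
def IsLeftKasch : Prop := ∀ I : Submodule R R, IsCoatom I → IsLeftAnnihilator I

/-- Every homomorphism with simple image from a right ideal to the right module `R` extends to an
endomorphism of the right module `R`. -/
def IsRightSimpleInjective : Prop :=
  ∀ (I : Submodule Rᵐᵒᵖ R) (f : I →ₗ[Rᵐᵒᵖ] R), IsSimpleModule Rᵐᵒᵖ (LinearMap.range f) →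
    ∃ g : R →ₗ[Rᵐᵒᵖ] R, ∀ x : I, g x = f x

/-- Every homomorphism with simple image from a left ideal to the left module `R` extends to an
endomorphism of the left module `R`. -/
def IsLeftSimpleInjective : Prop :=
  ∀ (I : Submodule R R) (f : I →ₗ[R] R), IsSimpleModule R (LinearMap.range f) →
    ∃ g : R →ₗ[R] R, ∀ x : I, g x = f x

end Rings

end SmallDualRing

/-! On either side, annihilators are the intersections of kernels of endomorphisms of the regular
module, so one module argument serves left and right ideals. From 2 to 1, an ideal K has a
complement T modulo J, and K ∩ T is small. For x outside K, an endomorphism killing K ∩ T but not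
the T-component of x, restricted to T, glues with zero on K (`exists_glue`). From 4 to 1, the same
gluing with K maximal among ideals avoiding x gives a map with simple image, which extends. From 1
to 3, annihilation turns I + L = R into r(I) ∩ r(L) = 0, so Zorn's lemma on right ideals yields
supplements of left ideals (`IsDual.exists_supplement`). These make R/J semisimple, and mutual
supplements lift idempotents. From 1 to 4, a map with simple image is recovered from an endomorphism
with matching kernel, using duality on the opposite side. -/

namespace SmallDualRing

/-! ### Gluing maps, small submodules and maximal submodules -/

section Modules

variable {S M P Q : Type*} [Ring S] [AddCommGroup M] [Module S M] [AddCommGroup P] [Module S P]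
  [AddCommGroup Q] [Module S Q]

/-- A submodule is an endomorphism annihilator if it is an intersection of kernels of
endomorphisms of the ambient module. For `R` as a module over itself on either side, these are the
annihilators of subsets of `R`. -/
def IsEndAnnihilator (I : Submodule S M) : Prop :=
  ∀ x, x ∉ I → ∃ g : M →ₗ[S] M, I ≤ LinearMap.ker g ∧ g x ≠ 0

theorem exists_comp_eq_of_ker_le {p : M →ₗ[S] P} (hp : Function.Surjective p) {h : M →ₗ[S] Q}
    (hh : LinearMap.ker p ≤ LinearMap.ker h) : ∃ f : P →ₗ[S] Q, f ∘ₗ p = h := by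
  refine ⟨(LinearMap.ker p).liftQ h hh ∘ₗ (p.quotKerEquivOfSurjective hp).symm.toLinearMap, ?_⟩
  ext m
  have : (p.quotKerEquivOfSurjective hp).symm (p m) = (LinearMap.ker p).mkQ m := by
    rw [LinearEquiv.symm_apply_eq]
    rfl
  simp [this]

/-- A map defined on the source of `φ` glues with the zero map on `K`. -/
theorem exists_glue (K : Submodule S P) (φ : M →ₗ[S] P) (g : M →ₗ[S] Q)
    (h : K.comap φ ≤ LinearMap.ker g) :
    ∃ f : ↥(K ⊔ LinearMap.range φ) →ₗ[S] Q,
      LinearMap.range f = LinearMap.range g ∧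
      ∀ (y : ↥(K ⊔ LinearMap.range φ)) (k : P) (m : M), k ∈ K → (y : P) = k + φ m → f y = g m := by
  let p₀ : K × M →ₗ[S] P := K.subtype.coprod φ
  have hp₀ : ∀ z, p₀ z ∈ K ⊔ LinearMap.range φ := fun z =>
    Submodule.add_mem_sup z.1.2 ⟨z.2, rfl⟩
  let p : K × M →ₗ[S] ↥(K ⊔ LinearMap.range φ) := p₀.codRestrict _ hp₀
  have hp : Function.Surjective p := by
    rintro ⟨y, hy⟩
    obtain ⟨k, hk, _, ⟨m, rfl⟩, rfl⟩ := Submodule.mem_sup.1 hy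
    exact ⟨(⟨k, hk⟩, m), rfl⟩
  have hker : LinearMap.ker p ≤ LinearMap.ker (g ∘ₗ LinearMap.snd S K M) := by
    rintro ⟨k, m⟩ hz
    have h0 : (k : P) + φ m = 0 := congrArg Subtype.val (LinearMap.mem_ker.1 hz)
    have : m ∈ K.comap φ := by
      rw [Submodule.mem_comap, ← neg_eq_of_add_eq_zero_right h0]
      exact K.neg_mem k.2
    exact h this
  obtain ⟨f, hf⟩ := exists_comp_eq_of_ker_le hp hker
  have hfp : ∀ z, f (p z) = g z.2 := fun z => LinearMap.congr_fun hf z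
  refine ⟨f, le_antisymm ?_ ?_, ?_⟩
  · rintro _ ⟨y, rfl⟩
    obtain ⟨z, rfl⟩ := hp y
    exact ⟨z.2, (hfp z).symm⟩
  · rintro _ ⟨m, rfl⟩
    exact ⟨p (0, m), hfp (0, m)⟩
  · intro y k m hk hy
    have : y = p (⟨k, hk⟩, m) := Subtype.ext hy
    rw [this, hfp]

theorem IsSmallSubmodule.mono {N N' : Submodule S M} (hN : IsSmallSubmodule N) (h : N' ≤ N) :
    IsSmallSubmodule N' :=
  fun K hK hK' => hN K hK (top_le_iff.1 (hK'.ge.trans (sup_le_sup_right h K)))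

theorem IsSmallSubmodule.le_jacobson {N : Submodule S M} (hN : IsSmallSubmodule N) :
    N ≤ Module.jacobson S M :=
  le_sInf fun m hm => by
    by_contra hle
    exact hN m hm.1 (hm.2 _ (right_lt_sup.2 hle))

/-- If `M ⧸ J` is semisimple, every submodule has a complement modulo `J`. -/
theorem exists_sup_eq_top_inf_le (J : Submodule S M) [IsSemisimpleModule S (M ⧸ J)]
    (K : Submodule S M) : ∃ T, K ⊔ T = ⊤ ∧ K ⊓ T ≤ J := by
  obtain ⟨T, hT⟩ := exists_isCompl (K.map J.mkQ)
  refine ⟨T.comap J.mkQ, ?_, ?_⟩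
  · refine top_le_iff.1 fun x _ => ?_
    have hx : J.mkQ x ∈ K.map J.mkQ ⊔ T := hT.sup_eq_top ▸ Submodule.mem_top
    obtain ⟨_, ⟨k, hk, rfl⟩, t, ht, hkt⟩ := Submodule.mem_sup.1 hx
    refine Submodule.mem_sup.2 ⟨k, hk, x - k, ?_, by abel⟩
    rw [Submodule.mem_comap, map_sub, ← hkt, add_sub_cancel_left]
    exact ht
  · rintro x ⟨hxK, hxT⟩
    have : J.mkQ x ∈ K.map J.mkQ ⊓ T := ⟨⟨x, hxK, rfl⟩, hxT⟩
    rw [hT.inf_eq_bot, Submodule.mem_bot] at this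
    simpa using this

/-- If `M ⧸ J` is semisimple with `J` small, and small submodules are endomorphism annihilators,
then all submodules are. -/
theorem isEndAnnihilator_of_small {J : Submodule S M} (hJ : IsSmallSubmodule J)
    [IsSemisimpleModule S (M ⧸ J)]
    (h : ∀ I : Submodule S M, IsSmallSubmodule I → IsEndAnnihilator I) (K : Submodule S M) :
    IsEndAnnihilator K := by
  intro x hx
  obtain ⟨T, hT, hKT⟩ := exists_sup_eq_top_inf_le J K
  have hxT : x ∈ K ⊔ T := hT ▸ Submodule.mem_top
  obtain ⟨k, hk, t, ht, rfl⟩ := Submodule.mem_sup.1 hxT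
  obtain ⟨c, hc, hct⟩ := h _ (hJ.mono hKT) t (fun h => hx (K.add_mem hk h.1))
  obtain ⟨f, -, hf⟩ := exists_glue K T.subtype (c ∘ₗ T.subtype) (fun y hy => hc ⟨hy, y.2⟩)
  have htop : ∀ y, LinearMap.id (R := S) y ∈ K ⊔ LinearMap.range T.subtype := fun y => by
    rw [Submodule.range_subtype, hT]
    exact Submodule.mem_top
  refine ⟨f ∘ₗ LinearMap.codRestrict _ LinearMap.id htop, fun y hy => ?_, ?_⟩
  · have := hf ⟨y, htop y⟩ y 0 hy (by simp)
    rw [map_zero] at this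
    exact this
  · have := hf ⟨k + t, htop _⟩ k ⟨t, ht⟩ hk rfl
    intro h0
    exact hct (this.symm.trans h0)

theorem exists_maximal_notMem {I : Submodule S M} {x : M} (hx : x ∉ I) :
    ∃ K : Submodule S M, I ≤ K ∧ Maximal (fun K : Submodule S M => x ∉ K) K := by
  refine zorn_le_nonempty₀ {K : Submodule S M | x ∉ K} (fun c hc hchain y hy => ?_) I hx
  refine ⟨sSup c, fun hmem => ?_, fun z hz => le_sSup hz⟩
  obtain ⟨K, hK, hxK⟩ := (Submodule.mem_sSup_of_directed ⟨y, hy⟩ hchain.directedOn).1 hmem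
  exact hc hK hxK

/-- The `S`-linear map `m ↦ e m • x` determined by an identification `e` of `M` with `S`. -/
def mulMap (e : M ≃ₗ[S] S) (x : P) : M →ₗ[S] P :=
  LinearMap.toSpanSingleton S P x ∘ₗ e.toLinearMap

theorem mulMap_apply (e : M ≃ₗ[S] S) (x : P) (m : M) : mulMap e x m = e m • x := rfl

theorem mulMap_symm_one (e : M ≃ₗ[S] S) (x : P) : mulMap e x (e.symm 1) = x := by
  simp [mulMap_apply]

theorem eq_top_of_symm_one_mem (e : M ≃ₗ[S] S) {N : Submodule S M} (h : e.symm 1 ∈ N) : N = ⊤ := by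
  refine top_le_iff.1 fun m _ => ?_
  have := N.smul_mem (e m) h
  rwa [← map_smul, smul_eq_mul, mul_one, e.symm_apply_apply] at this

/-- If `y • x` (via `e`) lies outside `K`, maximality puts `x` in `K` plus its span, so `1 - s y` is
in the preimage for some `s`. Adding `y` then generates everything. -/
theorem isCoatom_comap_mulMap (e : M ≃ₗ[S] S) {x : P} {K : Submodule S P}
    (hK : Maximal (fun K : Submodule S P => x ∉ K) K) : IsCoatom (K.comap (mulMap e x)) := by
  refine ⟨fun h => hK.1 ?_, fun N hN => ?_⟩
  · have : e.symm 1 ∈ K.comap (mulMap e x) := h ▸ Submodule.mem_top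
    rwa [Submodule.mem_comap, mulMap_symm_one] at this
  · obtain ⟨hle, y, hyN, hy⟩ := SetLike.lt_iff_le_and_exists.1 hN
    have hlt : K < K ⊔ S ∙ mulMap e x y :=
      left_lt_sup.2 fun h => hy (h (Submodule.mem_span_singleton_self _))
    have hx : x ∈ K ⊔ S ∙ mulMap e x y := by
      by_contra hx
      exact hK.not_prop_of_gt hlt hx
    obtain ⟨k, hk, _, hz, hkz⟩ := Submodule.mem_sup.1 hx
    obtain ⟨s, rfl⟩ := Submodule.mem_span_singleton.1 hz
    have h1 : e.symm 1 - s • y ∈ N := hle (by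
      rw [Submodule.mem_comap, map_sub, mulMap_symm_one, map_smul, sub_eq_of_eq_add hkz.symm]
      exact hk)
    refine eq_top_of_symm_one_mem e ?_
    have := N.add_mem h1 (N.smul_mem s hyN)
    rwa [sub_add_cancel] at this

/-- If maximal submodules are endomorphism annihilators and homomorphisms with simple image extend,
then all submodules are endomorphism annihilators. -/
theorem isEndAnnihilator_of_coatom (e : M ≃ₗ[S] S)
    (hK : ∀ N : Submodule S M, IsCoatom N → IsEndAnnihilator N)
    (hinj : ∀ (I : Submodule S M) (f : I →ₗ[S] M), IsSimpleModule S (LinearMap.range f) →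
      ∃ g : M →ₗ[S] M, ∀ x : I, g x = f x)
    (I : Submodule S M) : IsEndAnnihilator I := by
  intro x hx
  obtain ⟨K, hIK, hmax⟩ := exists_maximal_notMem hx
  have hN := isCoatom_comap_mulMap e hmax
  obtain ⟨g, hNg, hg⟩ := hK _ hN (e.symm 1) (fun h => hN.1 (eq_top_of_symm_one_mem e h))
  obtain ⟨f, hrange, hf⟩ := exists_glue K (mulMap e x) g hNg
  have hker : LinearMap.ker g = K.comap (mulMap e x) := by
    refine ((hN.le_iff.1 hNg).resolve_left fun h => hg ?_)
    rw [← LinearMap.mem_ker, h]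
    exact Submodule.mem_top
  have hsimple : IsSimpleModule S (LinearMap.range f) := by
    rw [hrange]
    have : IsSimpleModule S (M ⧸ LinearMap.ker g) := by
      rw [isSimpleModule_iff_isCoatom, hker]
      exact hN
    exact IsSimpleModule.congr g.quotKerEquivRange.symm
  obtain ⟨F, hF⟩ := hinj _ f hsimple
  refine ⟨F, fun y hy => ?_, ?_⟩
  · have hyK := hIK hy
    have := hf ⟨y, Submodule.mem_sup_left hyK⟩ y 0 hyK (by simp)
    rw [LinearMap.mem_ker, hF ⟨y, Submodule.mem_sup_left hyK⟩, this, map_zero]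
  · have hxm : x ∈ LinearMap.range (mulMap e x) := ⟨e.symm 1, mulMap_symm_one e x⟩
    rw [hF ⟨x, Submodule.mem_sup_right hxm⟩,
      hf ⟨x, Submodule.mem_sup_right hxm⟩ 0 (e.symm 1) K.zero_mem (by simp [mulMap_symm_one])]
    exact hg

/-- If all submodules are endomorphism annihilators and endomorphisms factor whenever their kernels
permit it, then homomorphisms with simple image extend. -/
theorem exists_extension_of_isEndAnnihilator (e : M ≃ₗ[S] S)
    (hann : ∀ I : Submodule S M, IsEndAnnihilator I)
    (hfac : ∀ t h : M →ₗ[S] M, LinearMap.ker t ≤ LinearMap.ker h → ∃ s : M →ₗ[S] M, s ∘ₗ t = h)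
    (I : Submodule S M) (f : I →ₗ[S] M) (hf : IsSimpleModule S (LinearMap.range f)) :
    ∃ g : M →ₗ[S] M, ∀ x : I, g x = f x := by
  have := IsSimpleModule.nontrivial S (LinearMap.range f)
  obtain ⟨⟨_, x, rfl⟩, hx⟩ := exists_ne (0 : LinearMap.range f)
  have hfx : f x ≠ 0 := fun h => hx (Subtype.ext h)
  obtain ⟨c, hc, hcx⟩ := hann ((LinearMap.ker f).map I.subtype) x (by
    rintro ⟨y, hy, hyx⟩
    rw [Subtype.ext hyx] at hy
    exact hfx hy)
  have hc' : ∀ y : I, f y = 0 → c y = 0 := fun y hy => hc ⟨y, hy, rfl⟩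
  let φ := mulMap e x
  let h' : M →ₗ[S] LinearMap.range f := f.rangeRestrict ∘ₗ φ
  have hφ : φ (e.symm 1) = x := mulMap_symm_one e x
  have hsurj : Function.Surjective h' := by
    refine (h'.surjective_or_eq_zero).resolve_right fun h0 => hx ?_
    exact (congrArg f.rangeRestrict hφ).symm.trans (LinearMap.congr_fun h0 (e.symm 1))
  have hco : IsCoatom (LinearMap.ker h') := by
    rw [← isSimpleModule_iff_isCoatom]
    exact IsSimpleModule.congr (h'.quotKerEquivOfSurjective hsurj)
  let t : M →ₗ[S] M := c ∘ₗ I.subtype ∘ₗ φ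
  have hle : LinearMap.ker h' ≤ LinearMap.ker t := fun m hm =>
    hc' (φ m) (congrArg Subtype.val (LinearMap.mem_ker.1 hm))
  have hker : LinearMap.ker t = LinearMap.ker h' := by
    refine (hco.le_iff.1 hle).resolve_left fun h => hcx ?_
    have : e.symm 1 ∈ LinearMap.ker t := h ▸ Submodule.mem_top
    have : c (φ (e.symm 1)) = 0 := this
    rwa [hφ] at this
  obtain ⟨s, hs⟩ := hfac t ((LinearMap.range f).subtype ∘ₗ h')
    (hker.le.trans fun m hm => congrArg Subtype.val (LinearMap.mem_ker.1 hm))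
  refine ⟨s ∘ₗ c, fun y => ?_⟩
  obtain ⟨m, hm⟩ := hsurj ⟨f y, y, rfl⟩
  have hm' : f (φ m) = f y := congrArg Subtype.val hm
  -- Elements with equal `f`-values have equal `c`-values, so it suffices to compare on the range of
  -- `φ`.
  have hcy := hc' (y - φ m) (by rw [map_sub, hm', sub_self])
  rw [AddSubgroupClass.coe_sub, map_sub, sub_eq_zero] at hcy
  calc s (c y) = s (t m) := by rw [hcy]; rfl
    _ = f (φ m) := LinearMap.congr_fun hs m
    _ = f y := hm'

/-- If `A` and `B` are mutual supplements, the components of `1` in `A` and `B` are idempotent. -/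
theorem isIdempotentElem_of_mutual_supplements {R : Type*} [Ring R] {A B : Submodule R R}
    (hA : ∀ A' ≤ A, A' ⊔ B = ⊤ → A' = A) (hB : ∀ B' ≤ B, A ⊔ B' = ⊤ → B' = B)
    {p q : R} (hp : p ∈ A) (hq : q ∈ B) (hpq : p + q = 1) : IsIdempotentElem p := by
  obtain rfl : q = 1 - p := eq_sub_of_add_eq' hpq
  have hcomm : p * (1 - p) = (1 - p) * p := by noncomm_ring
  -- The set of `x p` with `x (1 - p)` in `A ∩ B` contains `p²`, while `1 - p²` is in `B`;
  -- minimality of `A` applies.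
  have hA' : Submodule.map (LinearMap.toSpanSingleton R R p)
      (Submodule.comap (LinearMap.toSpanSingleton R R (1 - p)) (A ⊓ B)) = A := by
    refine hA _ ?_ ?_
    · rintro _ ⟨x, -, rfl⟩
      exact A.smul_mem x hp
    · rw [Ideal.eq_top_iff_one]
      refine Submodule.mem_sup.2 ⟨p * p, ⟨p, ⟨?_, B.smul_mem p hq⟩, rfl⟩, p * (1 - p) + (1 - p),
        B.add_mem (B.smul_mem p hq) hq, by noncomm_ring⟩
      change p * (1 - p) ∈ A
      rw [hcomm]
      exact A.smul_mem _ hp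
  obtain ⟨x, ⟨hxA, hxB⟩, hx⟩ : (1 - p) * p ∈ Submodule.map (LinearMap.toSpanSingleton R R p)
      (Submodule.comap (LinearMap.toSpanSingleton R R (1 - p)) (A ⊓ B)) :=
    hA'.symm ▸ A.smul_mem _ hp
  change x * (1 - p) ∈ A at hxA
  change x * p = (1 - p) * p at hx
  have hB' : LinearMap.ker (LinearMap.toSpanSingleton R R p) = B := by
    refine hB _ (fun z hz => ?_) ?_
    · have hz : z * p = 0 := hz
      have : z = z * (1 - p) := by rw [mul_sub, hz, mul_one, sub_zero]
      rw [this]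
      exact B.smul_mem z hq
    · rw [Ideal.eq_top_iff_one]
      -- Since `x p = (1 - p) p`, this element of `A` is just `p + x`.
      refine Submodule.mem_sup.2 ⟨p + ((1 - p) * p + x * (1 - p)),
        A.add_mem hp (A.add_mem (A.smul_mem _ hp) hxA), (1 - p) - x, ?_, ?_⟩
      · change ((1 - p) - x) * p = 0
        rw [sub_mul, hx, sub_self]
      · rw [mul_sub, hx]
        noncomm_ring
  have h0 : (1 - p) * p = 0 := by
    rw [← hB'] at hq
    exact hq
  rw [sub_mul, one_mul, sub_eq_zero] at h0
  exact h0.symm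

end Modules

/-! ### One-sided ideals and the Jacobson radical -/

section Rings

variable {R : Type*} [Ring R]

open MulOpposite

theorem leftLinearMap_apply (g : R →ₗ[R] R) (y : R) : g y = y * g 1 := by
  rw [← smul_eq_mul, ← map_smul, smul_eq_mul, mul_one]

theorem isLeftAnnihilator_iff_isEndAnnihilator (I : Submodule R R) :
    IsLeftAnnihilator I ↔ IsEndAnnihilator I := by
  constructor
  · rintro ⟨X, rfl⟩ x hx
    obtain ⟨c, hc, hxc⟩ : ∃ c ∈ X, x * c ≠ 0 := by
      by_contra! h
      exact hx h
    exact ⟨LinearMap.toSpanSingleton R R c, fun y hy => hy c hc, hxc⟩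
  · intro h
    rw [isLeftAnnihilator_iff]
    refine le_antisymm (fun x hx => ?_) (fun x hx y hy => hy x hx)
    by_contra hxI
    obtain ⟨g, hg, hgx⟩ := h x hxI
    exact hgx (leftLinearMap_apply g x ▸
      hx (g 1) (fun y hy => leftLinearMap_apply g y ▸ hg hy))

theorem rightLinearMap_apply (g : R →ₗ[Rᵐᵒᵖ] R) (y : R) : g y = g 1 * y := by
  have := map_smul g (op y) 1
  rwa [op_smul_eq_mul, op_smul_eq_mul, one_mul] at this

theorem isRightAnnihilator_iff_isEndAnnihilator (I : Submodule Rᵐᵒᵖ R) :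
    IsRightAnnihilator I ↔ IsEndAnnihilator I := by
  constructor
  · rintro ⟨X, rfl⟩ x hx
    obtain ⟨c, hc, hxc⟩ : ∃ c ∈ X, c * x ≠ 0 := by
      by_contra! h
      exact hx h
    exact ⟨DistribSMul.toLinearMap Rᵐᵒᵖ R c, fun y hy => hy c hc, hxc⟩
  · intro h
    rw [isRightAnnihilator_iff]
    refine le_antisymm (fun x hx => ?_) (fun x hx y hy => hy x hx)
    by_contra hxI
    obtain ⟨g, hg, hgx⟩ := h x hxI
    exact hgx (rightLinearMap_apply g x ▸
      hx (g 1) (fun y hy => rightLinearMap_apply g y ▸ hg hy))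

/-- Left-linear maps are right multiplications, so the kernel condition puts `g 1` in the double
annihilator of the right ideal generated by `t 1`. Hence the duality used is on the other side. -/
theorem IsRightDual.exists_comp_eq (h : IsRightDual R) (t g : R →ₗ[R] R)
    (htg : LinearMap.ker t ≤ LinearMap.ker g) : ∃ s : R →ₗ[R] R, s ∘ₗ t = g := by
  have hmem : g 1 ∈ Rᵐᵒᵖ ∙ t 1 := by
    rw [← (isRightAnnihilator_iff _).1 (h (Rᵐᵒᵖ ∙ t 1))]
    intro y hy
    have : y * t 1 = 0 := hy _ (Submodule.mem_span_singleton_self _)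
    rw [← leftLinearMap_apply] at this ⊢
    exact htg this
  obtain ⟨u, hu⟩ := Submodule.mem_span_singleton.1 hmem
  refine ⟨LinearMap.toSpanSingleton R R u.unop, LinearMap.ext_ring ?_⟩
  rw [← hu]
  rfl

theorem IsLeftDual.exists_comp_eq (h : IsLeftDual R) (t g : R →ₗ[Rᵐᵒᵖ] R)
    (htg : LinearMap.ker t ≤ LinearMap.ker g) : ∃ s : R →ₗ[Rᵐᵒᵖ] R, s ∘ₗ t = g := by
  have hmem : g 1 ∈ R ∙ t 1 := by
    rw [← (isLeftAnnihilator_iff _).1 (h (R ∙ t 1))]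
    intro y hy
    have : t 1 * y = 0 := hy _ (Submodule.mem_span_singleton_self _)
    rw [← rightLinearMap_apply] at this ⊢
    exact htg this
  obtain ⟨u, hu⟩ := Submodule.mem_span_singleton.1 hmem
  refine ⟨DistribSMul.toLinearMap Rᵐᵒᵖ R u, LinearMap.ext fun y => ?_⟩
  rw [rightLinearMap_apply g, ← hu, smul_eq_mul, mul_assoc, ← rightLinearMap_apply t]
  rfl

theorem isUnit_one_sub_of_mem_jacobson {j : R} (hj : j ∈ Ring.jacobson R) : IsUnit (1 - j) := by
  have key : ∀ {a : R}, 1 - a ∈ Ring.jacobson R → ∃ b, b * a = 1 := fun {a} ha => by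
    rw [← Ideal.jacobson_bot] at ha
    obtain ⟨b, hb⟩ := Ideal.exists_mul_sub_mem_of_sub_one_mem_jacobson a
      (by rw [← neg_sub]; exact neg_mem ha)
    exact ⟨b, sub_eq_zero.1 hb⟩
  obtain ⟨b, hb⟩ := key (a := 1 - j) (by rwa [sub_sub_cancel])
  -- The left inverse `b` is also 1 modulo J, hence left invertible, so it is a two-sided inverse.
  obtain ⟨c, hc⟩ := key (a := b) (by
    have : 1 - b = -(b * j) := by
      rw [mul_sub, mul_one] at hb
      rw [sub_eq_iff_eq_add, ← hb, neg_add_eq_sub]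
    rw [this]
    exact neg_mem (Ideal.mul_mem_left _ _ hj))
  have : c = 1 - j := left_inv_eq_right_inv hc hb
  exact ⟨⟨1 - j, b, this ▸ hc, hb⟩, rfl⟩

variable (R) in
/-- The Jacobson radical as a right ideal. -/
def rightJacobson : Submodule Rᵐᵒᵖ R where
  carrier := Ring.jacobson R
  zero_mem' := zero_mem _
  add_mem' := add_mem
  smul_mem' := fun c _ hx => Ideal.mul_mem_right c.unop _ hx

theorem isSmallSubmodule_jacobson : IsSmallSubmodule (Ring.jacobson R : Submodule R R) := by
  intro K hK h
  have h1 : (1 : R) ∈ Ring.jacobson R ⊔ K := h ▸ Submodule.mem_top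
  obtain ⟨j, hj, k, hk, hjk⟩ := Submodule.mem_sup.1 h1
  obtain rfl : k = 1 - j := eq_sub_of_add_eq' hjk
  exact hK (Ideal.eq_top_of_isUnit_mem K hk (isUnit_one_sub_of_mem_jacobson hj))

theorem isSmallSubmodule_rightJacobson : IsSmallSubmodule (rightJacobson R) := by
  intro K hK h
  have h1 : (1 : R) ∈ rightJacobson R ⊔ K := h ▸ Submodule.mem_top
  obtain ⟨j, hj, k, hk, hjk⟩ := Submodule.mem_sup.1 h1
  obtain rfl : k = 1 - j := eq_sub_of_add_eq' hjk
  obtain ⟨u, hu⟩ := isUnit_one_sub_of_mem_jacobson hj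
  refine hK (top_le_iff.1 fun x _ => ?_)
  have := K.smul_mem (op (↑u⁻¹ * x)) hk
  rwa [op_smul_eq_mul, ← hu, Units.mul_inv_cancel_left] at this

theorem isSemilocal_iff_isSemisimpleModule :
    IsSemilocal R ↔ IsSemisimpleModule R (R ⧸ Ring.jacobson R) := by
  let l : R ⧸ Ring.jacobson R →ₛₗ[Ideal.Quotient.mk (Ring.jacobson R)] R ⧸ Ring.jacobson R :=
    { toFun := id
      map_add' := fun _ _ => rfl
      map_smul' := fun r x => by
        obtain ⟨x, rfl⟩ := Ideal.Quotient.mk_surjective x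
        rfl }
  have : RingHomSurjective (Ideal.Quotient.mk (Ring.jacobson R)) := ⟨Ideal.Quotient.mk_surjective⟩
  exact (l.isSemisimpleModule_iff_of_bijective Function.bijective_id).symm

theorem IsSemilocal.isSemisimpleModule_right (h : IsSemilocal R) :
    IsSemisimpleModule Rᵐᵒᵖ (R ⧸ rightJacobson R) := by
  have : IsSemisimpleRing (R ⧸ Ring.jacobson R) := h
  let σ : Rᵐᵒᵖ →+* (R ⧸ Ring.jacobson R)ᵐᵒᵖ := RingHom.op (Ideal.Quotient.mk (Ring.jacobson R))
  have : RingHomSurjective σ := ⟨fun x => by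
    obtain ⟨y, hy⟩ := Ideal.Quotient.mk_surjective x.unop
    exact ⟨op y, unop_injective hy⟩⟩
  let l₀ : R →ₛₗ[σ] (R ⧸ Ring.jacobson R)ᵐᵒᵖ :=
    { toFun := fun x => op (Ideal.Quotient.mk (Ring.jacobson R) x)
      map_add' := fun _ _ => rfl
      map_smul' := fun _ _ => rfl }
  have hker : LinearMap.ker l₀ = rightJacobson R := by
    ext x
    rw [LinearMap.mem_ker]
    change op (Ideal.Quotient.mk (Ring.jacobson R) x) = 0 ↔ x ∈ Ring.jacobson R
    rw [op_eq_zero_iff, Ideal.Quotient.eq_zero_iff_mem]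
  let l : R ⧸ rightJacobson R →ₛₗ[σ] (R ⧸ Ring.jacobson R)ᵐᵒᵖ :=
    (rightJacobson R).liftQ l₀ hker.ge
  refine (l.isSemisimpleModule_iff_of_bijective ⟨?_, ?_⟩).2
    (inferInstanceAs (IsSemisimpleRing (R ⧸ Ring.jacobson R)ᵐᵒᵖ))
  · exact LinearMap.ker_eq_bot.1 (Submodule.ker_liftQ_eq_bot _ _ _ hker.le)
  · intro y
    obtain ⟨x, hx⟩ := Ideal.Quotient.mk_surjective y.unop
    exact ⟨(rightJacobson R).mkQ x, unop_injective hx⟩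

theorem IsSemilocal.isDual (h : IsSemilocal R) (hd : IsSmallDual R) : IsDual R := by
  have := isSemilocal_iff_isSemisimpleModule.1 h
  have := h.isSemisimpleModule_right
  refine ⟨fun I => ?_, fun I => ?_⟩
  · rw [isLeftAnnihilator_iff_isEndAnnihilator]
    exact isEndAnnihilator_of_small isSmallSubmodule_jacobson
      (fun N hN => (isLeftAnnihilator_iff_isEndAnnihilator N).1 (hd.1 N hN)) I
  · rw [isRightAnnihilator_iff_isEndAnnihilator]
    exact isEndAnnihilator_of_small isSmallSubmodule_rightJacobson
      (fun N hN => (isRightAnnihilator_iff_isEndAnnihilator N).1 (hd.2 N hN)) I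

/-! ### Supplements and semiperfectness of dual rings -/

theorem leftAnn_anti {X Y : Set R} (h : X ⊆ Y) : leftAnn Y ≤ leftAnn X :=
  fun _ hr x hx => hr x (h hx)

theorem rightAnn_anti {X Y : Set R} (h : X ⊆ Y) : rightAnn Y ≤ rightAnn X :=
  fun _ hr x hx => hr x (h hx)

/-- In a dual ring, supplements of left ideals exist inside any given left ideal that already spans
the ring together with the ideal to be supplemented. -/
theorem IsDual.exists_supplement (h : IsDual R) {I C : Submodule R R} (hIC : I ⊔ C = ⊤) :
    ∃ K ≤ C, I ⊔ K = ⊤ ∧ ∀ K' ≤ K, I ⊔ K' = ⊤ → K' = K := by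
  have hl := fun L => (isLeftAnnihilator_iff L).1 (h.1 L)
  have hr := fun L => (isRightAnnihilator_iff L).1 (h.2 L)
  have hiff : ∀ L : Submodule R R, I ⊔ L = ⊤ ↔
      Disjoint (rightAnn (I : Set R)) (rightAnn (L : Set R)) := by
    intro L
    have hsup : rightAnn (I : Set R) ⊓ rightAnn (L : Set R) = rightAnn (↑(I ⊔ L) : Set R) := by
      refine le_antisymm (fun x hx y hy => ?_) (le_inf ?_ ?_)
      · obtain ⟨a, ha, b, hb, rfl⟩ := Submodule.mem_sup.1 hy
        rw [add_mul, hx.1 a ha, hx.2 b hb, add_zero]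
      · exact rightAnn_anti (le_sup_left : I ≤ I ⊔ L)
      · exact rightAnn_anti (le_sup_right : L ≤ I ⊔ L)
    rw [disjoint_iff, hsup]
    constructor
    · intro hT
      refine (Submodule.eq_bot_iff _).2 fun x hx => ?_
      have := hx 1 (by rw [hT]; exact Submodule.mem_top)
      rwa [one_mul] at this
    · intro hB
      rw [← hl (I ⊔ L), hB]
      exact top_le_iff.1 fun r _ x hx => by rw [(Submodule.mem_bot _).1 hx, mul_zero]
  -- A maximal `T` disjoint from r(I) corresponds, by order reversal, to a minimal l(T) with I +
  -- l(T) = R.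
  obtain ⟨T, hCT, hT⟩ := zorn_le_nonempty₀
    {T : Submodule Rᵐᵒᵖ R | Disjoint (rightAnn (I : Set R)) T}
    (fun c hc hchain y hy => ⟨sSup c, by
      change Disjoint _ _
      rw [hchain.directedOn.disjoint_sSup_right]
      exact fun b hb => hc hb, fun z hz => le_sSup hz⟩)
    (rightAnn (C : Set R)) ((hiff C).1 hIC)
  refine ⟨leftAnn (T : Set R), (leftAnn_anti hCT).trans (hl C).le, ?_, fun K' hK' hIK' => ?_⟩
  · rw [hiff, hr]
    exact hT.1
  · have hle : T ≤ rightAnn (K' : Set R) := (hr T).ge.trans (rightAnn_anti hK')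
    rw [hT.eq_of_le ((hiff K').1 hIK') hle, hl]

theorem IsDual.isSemilocal (h : IsDual R) : IsSemilocal R := by
  refine isSemilocal_iff_isSemisimpleModule.2 ?_
  rw [isSemisimpleModule_iff]
  refine ⟨fun N => ?_⟩
  let J : Submodule R R := Ring.jacobson R
  let I := N.comap J.mkQ
  obtain ⟨K, -, hK, hmin⟩ := h.exists_supplement (I := I) (C := ⊤) (sup_top_eq _)
  have hsmall : IsSmallSubmodule (I ⊓ K) := by
    intro L hL hIL
    -- By modularity `K = (I ⊓ K) ⊔ (K ⊓ L)`, so `K ⊓ L` still spans together with `I`.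
    have hKL : K ⊓ L = K := by
      refine hmin _ inf_le_left ?_
      have : I ⊓ K ⊔ K ⊓ L = K := by
        rw [inf_comm K L, ← sup_inf_assoc_of_le L (inf_le_right : I ⊓ K ≤ K), hIL, top_inf_eq]
      rw [← hK, ← this, ← sup_assoc, sup_inf_self, this]
    exact hL (top_le_iff.1 (hIL.ge.trans
      (sup_le (inf_le_right.trans (inf_eq_left.1 hKL)) le_rfl)))
  have hJ : I ⊓ K ≤ J := hsmall.le_jacobson
  have hN : I.map J.mkQ = N := Submodule.map_comap_eq_of_surjective J.mkQ_surjective N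
  refine ⟨K.map J.mkQ, ?_, ?_⟩
  · rw [Submodule.disjoint_def]
    rintro _ hx ⟨k, hk, rfl⟩
    exact (Submodule.Quotient.mk_eq_zero J).2 (hJ ⟨hx, hk⟩)
  · rw [codisjoint_iff, ← hN, ← Submodule.map_sup, hK, Submodule.map_top, Submodule.range_mkQ]

theorem IsDual.isSemiperfect (h : IsDual R) : IsSemiperfect R := by
  refine ⟨h.isSemilocal, fun a ha => ?_⟩
  obtain ⟨a, rfl⟩ := Ideal.Quotient.mk_surjective a
  have hspan : (R ∙ (1 - a)) ⊔ (R ∙ a) = ⊤ := by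
    rw [Ideal.eq_top_iff_one]
    exact Submodule.mem_sup.2 ⟨1 - a, Submodule.mem_span_singleton_self _, a,
      Submodule.mem_span_singleton_self _, sub_add_cancel 1 a⟩
  obtain ⟨A, hAa, hA, hAmin⟩ := h.exists_supplement hspan
  rw [sup_comm] at hA
  obtain ⟨B, hBa, hB, hBmin⟩ := h.exists_supplement hA
  obtain ⟨p, hp, q, hq, hpq⟩ := Submodule.mem_sup.1 (hB ▸ Submodule.mem_top : (1 : R) ∈ A ⊔ B)
  -- As `B` lies in `R (1 - a)`, minimality of `A` against `R (1 - a)` implies minimality against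
  -- `B`.
  have hid : IsIdempotentElem p := by
    refine isIdempotentElem_of_mutual_supplements (fun A' hA' hAB => hAmin A' hA' ?_) hBmin hp hq hpq
    rw [sup_comm]
    exact top_le_iff.1 (hAB.ge.trans (sup_le_sup_left hBa A'))
  refine ⟨p, hid, ?_⟩
  obtain ⟨r, hr⟩ := Submodule.mem_span_singleton.1 (hAa hp)
  obtain ⟨s, hs⟩ := Submodule.mem_span_singleton.1 (hBa hq)
  rw [smul_eq_mul] at hr hs
  have h1 : (1 - a) * a = a * (1 - a) := by noncomm_ring
  set π := Ideal.Quotient.mk (Ring.jacobson R)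
  have h2 : π (a * (1 - a)) = 0 := by
    rw [mul_sub, mul_one, map_sub, map_mul, ha.eq, sub_self]
  have h3 : π (p * (1 - a)) = 0 := by rw [← hr, mul_assoc, map_mul, h2, mul_zero]
  have h4 : π (q * a) = 0 := by rw [← hs, mul_assoc, h1, map_mul, h2, mul_zero]
  have h5 : p - a = p * (1 - a) - q * a := by
    rw [eq_sub_of_add_eq' hpq]
    noncomm_ring
  rw [← sub_eq_zero, ← map_sub, h5, map_sub, h3, h4, sub_zero]

/-! ### Duality versus Kasch and simple injective conditions -/

theorem IsDual.isLeftSimpleInjective (h : IsDual R) : IsLeftSimpleInjective R :=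
  exists_extension_of_isEndAnnihilator (LinearEquiv.refl R R)
    (fun I => (isLeftAnnihilator_iff_isEndAnnihilator I).1 (h.1 I)) h.2.exists_comp_eq

theorem IsDual.isRightSimpleInjective (h : IsDual R) : IsRightSimpleInjective R :=
  exists_extension_of_isEndAnnihilator (opLinearEquiv Rᵐᵒᵖ : R ≃ₗ[Rᵐᵒᵖ] Rᵐᵒᵖ)
    (fun I => (isRightAnnihilator_iff_isEndAnnihilator I).1 (h.2 I)) h.1.exists_comp_eq

theorem IsLeftKasch.isLeftDual (hK : IsLeftKasch R) (hi : IsLeftSimpleInjective R) :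
    IsLeftDual R := fun I =>
  (isLeftAnnihilator_iff_isEndAnnihilator I).2 <|
    isEndAnnihilator_of_coatom (LinearEquiv.refl R R)
      (fun N hN => (isLeftAnnihilator_iff_isEndAnnihilator N).1 (hK N hN)) hi I

theorem IsRightKasch.isRightDual (hK : IsRightKasch R) (hi : IsRightSimpleInjective R) :
    IsRightDual R := fun I =>
  (isRightAnnihilator_iff_isEndAnnihilator I).2 <|
    isEndAnnihilator_of_coatom (opLinearEquiv Rᵐᵒᵖ : R ≃ₗ[Rᵐᵒᵖ] Rᵐᵒᵖ)
      (fun N hN => (isRightAnnihilator_iff_isEndAnnihilator N).1 (hK N hN)) hi I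

end Rings

end SmallDualRing

theorem theorem3p1 (R : Type*) [Ring R] :
    List.TFAE [
      SmallDualRing.IsDual R,
      SmallDualRing.IsSemilocal R ∧ SmallDualRing.IsSmallDual R,
      SmallDualRing.IsSemiperfect R ∧ SmallDualRing.IsSmallDual R,
      (SmallDualRing.IsLeftKasch R ∧ SmallDualRing.IsRightKasch R) ∧
        (SmallDualRing.IsLeftSimpleInjective R ∧ SmallDualRing.IsRightSimpleInjective R)] := by
  tfae_have 1 → 3 := fun h => ⟨h.isSemiperfect, fun I _ => h.1 I, fun I _ => h.2 I⟩
  tfae_have 3 → 2 := fun h => ⟨h.1.1, h.2⟩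
  tfae_have 2 → 1 := fun h => h.1.isDual h.2
  tfae_have 1 → 4 := fun h => ⟨⟨fun I _ => h.1 I, fun I _ => h.2 I⟩,
    h.isLeftSimpleInjective, h.isRightSimpleInjective⟩
  tfae_have 4 → 1 := fun h => ⟨h.1.1.isLeftDual h.2.1, h.1.2.isRightDual h.2.2⟩
  tfae_finish
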